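/- **Setting.** Let $d\ge 0$ be an integer and let $\|\cdot\|$ be the Euclidean norm on $\mathbb{R}^d$. Let $F\colon\mathbb{R}^d\to\mathbb{R}^d$ be $L$-Lipschitz, let $G\colon\mathbb{R}^d\rightrightarrows\mathbb{R}^d$ be maximally monotone, and let $\rho>0$ be such that $F+G$ is maximally $\rho$-cohypomonotone, i.e. $\langle u-v,x-y\rangle\ge-\rho\|u-v\|^2$ for all $u\in(F+G)(x)$, $v\in(F+G)(y)$, and the graph of $F+G$ is not strictly contained in the graph of another operator with this property. Let $\rho<\eta$ and $\eta L<1$, let $x^\star$ be a solution of $0\in F(x^\star)+G(x^\star)$, and let $x_0\in\mathbb{R}^d$. For a set-valued operator $A$ write $J_A=(\mathrm{Id}+A)^{-1}$. **Algorithm.** Let $\alpha=1-\rho/\eta$, $\beta_k=\frac1{k+2}$ and $N_k=\left\lceil\frac{4(1+\eta L)}{1-\eta L}\log\big(98\sqrt{k+2}\,\log(k+2)\big)\right\rceil$. The inexact Halpern iteration is $$x_{k+1}=\beta_kx_0+(1-\beta_k)\big((1-\alpha)x_k+\alpha\,\widetilde J(x_k)\big),\qquad k=0,1,2,\dots,$$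 where $\widetilde J(x_k)=z_{N_k}$ is the result of $N_k$ steps of the forward-backward-forward method $$z_0=x_k,\qquad z_{t+1/2}=J_{\tau\eta G}(z_t-\tau B(z_t)),\qquad z_{t+1}=z_{t+1/2}+\tau B(z_t)-\tau B(z_{t+1/2}),$$ with $B(z)=z+\eta F(z)-x_k$ and $\tau=\frac1{2(1+\eta L)}$. One first-order oracle call consists of one evaluation of $F$ and one evaluation of a resolvent of $G$. **Claim.** For every $\varepsilon>0$, let $K=\left\lceil\frac{4\|x_0-x^\star\|}{(\eta-\rho)\varepsilon}\right\rceil$. Then $J_{\eta(F+G)}(x_K)$ is a single point and $$\eta^{-1}\big\|(\mathrm{Id}-J_{\eta(F+G)})(x_K)\big\|\le\varepsilon .$$ Moreover, the total number of first-order oracle calls made to compute $x_K$ is $$\widetilde O\left(\frac{(1+\eta L)\,\|x_0-x^\star\|}{\varepsilon\,(\eta-\rho)\,(1-\eta L)}\right),$$ in the following sense: there are absolute constants $C>0$ and $p\in\mathbb{N}$, independent of $d,F,G,L,\rho,\eta,x_0,x^\star,\varepsilon$, such that with $X=\frac{\|x_0-x^\star\|}{\varepsilon(\eta-\rho)}$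 the number of calls is at most $$C\,\frac{1+\eta L}{1-\eta L}\,\max\{1,X\}\,\big(\log(2+X)\big)^p .$$ -/

import Mathlib

open scoped NNReal

noncomputable section

namespace InexactHalpern

/-- The space `ℝ^d` with the Euclidean norm. -/
abbrev E (d : ℕ) : Type := EuclideanSpace ℝ (Fin d)

/-- A set-valued operator `A : ℝ^d ⇉ ℝ^d`; its graph is `{(x, u) | u ∈ A x}`. -/
abbrev SetOp (d : ℕ) : Type := E d → Set (E d)

variable {d : ℕ}

/-- The operator `F + G` for a single-valued `F` and a set-valued `G`. -/
def addOp (F : E d → E d) (G : SetOp d) : SetOp d :=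
  fun x => {w | ∃ u ∈ G x, w = F x + u}

/-- The operator `c A`. -/
def smulOp (c : ℝ) (A : SetOp d) : SetOp d :=
  fun x => {w | ∃ u ∈ A x, w = c • u}

/-- `A` is monotone. -/
def IsMonotoneOp (A : SetOp d) : Prop :=
  ∀ x y u v : E d, u ∈ A x → v ∈ A y → 0 ≤ inner ℝ (u - v) (x - y)

/-- `A` is maximally monotone: no monotone operator has a strictly larger graph. -/
def IsMaximallyMonotone (A : SetOp d) : Prop :=
  IsMonotoneOp A ∧ ∀ A' : SetOp d, IsMonotoneOp A' → (∀ x, A x ⊆ A' x) → A' = A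

/-- `A` is `ρ`-cohypomonotone. -/
def IsCohypomonotone (ρ : ℝ) (A : SetOp d) : Prop :=
  ∀ x y u v : E d, u ∈ A x → v ∈ A y → -ρ * ‖u - v‖ ^ 2 ≤ inner ℝ (u - v) (x - y)

/-- `A` is maximally `ρ`-cohypomonotone: no `ρ`-cohypomonotone operator has a strictly larger
graph. -/
def IsMaximallyCohypomonotone (ρ : ℝ) (A : SetOp d) : Prop :=
  IsCohypomonotone ρ A ∧
    ∀ A' : SetOp d, IsCohypomonotone ρ A' → (∀ x, A x ⊆ A' x) → A' = A

/-- The resolvent `J_A = (Id + A)⁻¹`, as a set-valued operator. -/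
def setResolvent (A : SetOp d) : SetOp d :=
  fun x => {y | ∃ u ∈ A y, x = y + u}

open Classical in
/-- A value of the resolvent `J_A` at `x` (the value, where `J_A` is single-valued; the arbitrary
point `0` where `J_A x` is empty). -/
def resolventMap (A : SetOp d) (x : E d) : E d :=
  if h : (setResolvent A x).Nonempty then h.some else 0

/-- The result of a computation with oracle access to `F` and to the resolvents of `G`, together
with the number of evaluations of `F` and of resolvents of `G` that it made. -/
structure Counted (α : Type) where
  /-- the computed value -/
  val : α
  /-- the number of evaluations of `F` -/
  evals : ℕ
  /-- the number of evaluations of resolvents of `G` -/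
  resolvents : ℕ

/-- Computations are composed by running one after the other; the counts add up, and operations
other than oracle queries are free. -/
instance : Monad Counted where
  pure a := ⟨a, 0, 0⟩
  bind c f := ⟨(f c.val).val, c.evals + (f c.val).evals, c.resolvents + (f c.val).resolvents⟩

/-- One call to the first-order oracle provides one evaluation of `F` and one resolvent of `G`;
this is the number of calls that a computation needs. -/
def Counted.oracleCalls {α : Type} (c : Counted α) : ℕ := max c.evals c.resolvents

/-- Query: evaluate `F` at `x`. -/
def queryF (F : E d → E d) (x : E d) : Counted (E d) := ⟨F x, 1, 0⟩

/-- Query: evaluate the resolvent `J_{cG}` at `x`. -/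
def queryResolvent (G : SetOp d) (c : ℝ) (x : E d) : Counted (E d) :=
  ⟨resolventMap (smulOp c G) x, 0, 1⟩

/-- The forward-backward-forward method `FBF(z₀, N, A, B_in, L_B)`, with step size
`τ = 1 / (2 L_B)` and `B = B_in - z₀`. The operator `A` is accessed through
`JA τ = J_{τ A}`, and the last argument is the number `N` of iterations. -/
def fbf (z₀ : E d) (JA : ℝ → E d → Counted (E d)) (Bin : E d → Counted (E d)) (LB : ℝ) :
    ℕ → Counted (E d)
  | 0 => pure z₀
  | t + 1 => do
    let τ : ℝ := 1 / (2 * LB)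
    let z ← fbf z₀ JA Bin LB t
    let b ← Bin z
    let w ← JA τ (z - τ • (b - z₀))
    let b' ← Bin w
    return w + τ • (b - z₀) - τ • (b' - z₀)

/-- The number `N_k` of inner iterations at outer iteration `k`. -/
def innerIterations (η L : ℝ) (k : ℕ) : ℕ :=
  ⌈4 * (1 + η * L) / (1 - η * L) *
    Real.log (98 * Real.sqrt ((k : ℝ) + 2) * Real.log ((k : ℝ) + 2))⌉₊

/-- The approximation `FBF(x, N, η G, Id + η F, 1 + η L)` of `J_{η(F+G)}(x)`. The resolvent
`J_{τ (η G)}` is the resolvent `J_{(τ η) G}` of `G`, and each evaluation of `Id + η F` evaluates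
`F` once. -/
def approxResolvent (F : E d → E d) (G : SetOp d) (η L : ℝ) (x : E d) (N : ℕ) :
    Counted (E d) :=
  fbf x (fun τ y => queryResolvent G (τ * η) y)
    (fun z => do
      let f ← queryF F z
      return z + η • f)
    (1 + η * L) N

/-- The inexact Halpern iteration: the computation of the iterate `x_k` from `x₀`, with
`β_k = 1 / (k + 2)` and `α = 1 - ρ / η`. -/
def halpern (F : E d → E d) (G : SetOp d) (η L ρ : ℝ) (x₀ : E d) : ℕ → Counted (E d)
  | 0 => pure x₀
  | k + 1 => do
    let α : ℝ := 1 - ρ / η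
    let β : ℝ := 1 / ((k : ℝ) + 2)
    let x ← halpern F G η L ρ x₀ k
    let J ← approxResolvent F G η L x (innerIterations η L k)
    return β • x₀ + (1 - β) • ((1 - α) • x + α • J)

end InexactHalpern

end

open InexactHalpern

/-! Let `J` be the resolvent of `η(F+G)` and `α = 1 - ρ/η > 0`. Cohypomonotonicity makes `x ↦ α(x -
J x)` 1-cocoercive, so `x ↦ x - α(x - J x)` is firmly nonexpansive and the outer loop is its Halpern
iteration, with error `e_k` equal to `α` times the error of the inner solver. That `J` has full
domain comes from Minty's theorem for `G` and Banach's fixed point theorem, since `ηL < 1`.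

With `p_k = α(x_k - J x_k)`, the potential `k(k+1)/2 ‖p_k‖² + (k+1)⟨p_k, x_k - x_0⟩` increases only
through the errors (`halpern_potential_step`). The inner problem is strongly monotone and Lipschitz,
so forward-backward-forward converges linearly, and `N_k` steps make `e_k` small relative to `p_k`.
The increments are then summable, which yields `‖p_k‖ = O(1/k)` (`halpern_displacement_le`). Since
`N_k` grows only logarithmically in `k`, summing it over `K` outer steps costs one logarithm. -/

namespace InexactHalpern

/-! ### Minty's theorem, by convex duality and compactness -/

section Minty

variable {V : Type*} [NormedAddCommGroup V] [InnerProductSpace ℝ V]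

theorem nonpos_of_forall_le_mul {δ C : ℝ} (hC : 0 ≤ C)
    (h : ∀ t : ℝ, 0 < t → t ≤ 1 → δ ≤ t * C) : δ ≤ 0 := by
  by_contra! hδ
  have h1 := h (δ / (C + δ)) (by positivity) (by rw [div_le_one (by positivity)]; linarith)
  rw [div_mul_eq_mul_div, le_div_iff₀ (by positivity)] at h1
  nlinarith

/-- The balls whose diameters are the segments `[a i, b i]` have a common point if the pairs
`(a i, b i)` are antitone. -/
theorem exists_common_point_of_antitone {ι : Type*} [Fintype ι] [Nonempty ι] (a b : ι → V)
    (hab : ∀ i j, inner ℝ (a i - a j) (b i - b j) ≤ 0) :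
    ∃ y, ∀ i, inner ℝ (a i - y) (b i - y) ≤ 0 := by
  classical
  set s : ι → V := fun i => a i + b i with hs
  -- `D l` is the minimum over `y` of the `l`-average of `⟨a i - y, b i - y⟩`, attained at half of
  -- `∑ l i • s i`: the dual of minimizing the largest of these products. The antitone hypothesis
  -- gives `D ≤ 0` on the simplex.
  set D : (ι → ℝ) → ℝ := fun l =>
    (∑ i, l i * inner ℝ (a i) (b i)) - ‖∑ i, l i • s i‖ ^ 2 / 4 with hD
  have hcont : Continuous D := by fun_prop
  have hne : (stdSimplex ℝ ι).Nonempty :=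
    ⟨_, single_mem_stdSimplex ℝ (Classical.arbitrary ι)⟩
  obtain ⟨l, hl, hmax⟩ := (isCompact_stdSimplex ℝ ι).exists_isMaxOn hne hcont.continuousOn
  have hDle : D l ≤ 0 := by
    have h1 : ∑ i, ∑ j, l i * l j * inner ℝ (a i - a j) (b i - b j) ≤ 0 :=
      Finset.sum_nonpos fun i _ => Finset.sum_nonpos fun j _ =>
        mul_nonpos_of_nonneg_of_nonpos (mul_nonneg (hl.1 i) (hl.1 j)) (hab i j)
    have h2 : ∑ i, ∑ j, l i * l j * inner ℝ (a i - a j) (b i - b j)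
        = 2 * (∑ i, l i * inner ℝ (a i) (b i))
          - 2 * inner ℝ (∑ i, l i • a i) (∑ i, l i • b i) := by
      have e1 : ∑ i, ∑ j, l i * l j * inner ℝ (a i) (b i)
          = ∑ i, l i * inner ℝ (a i) (b i) := by
        refine Finset.sum_congr rfl fun i _ => ?_
        rw [← Finset.sum_mul, ← Finset.mul_sum, hl.2, mul_one]
      have e2 : ∑ i, ∑ j, l i * l j * inner ℝ (a j) (b j)
          = ∑ i, l i * inner ℝ (a i) (b i) := by
        rw [Finset.sum_comm, ← e1]
        exact Finset.sum_congr rfl fun i _ => Finset.sum_congr rfl fun j _ => by ring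
      have e3 : ∑ i, ∑ j, l i * l j * inner ℝ (a i) (b j)
          = inner ℝ (∑ i, l i • a i) (∑ i, l i • b i) := by
        rw [sum_inner]
        refine Finset.sum_congr rfl fun i _ => ?_
        rw [inner_sum]
        refine Finset.sum_congr rfl fun j _ => ?_
        rw [real_inner_smul_left, real_inner_smul_right]; ring
      have e4 : ∑ i, ∑ j, l i * l j * inner ℝ (a j) (b i)
          = inner ℝ (∑ i, l i • a i) (∑ i, l i • b i) := by
        rw [Finset.sum_comm, ← e3]
        exact Finset.sum_congr rfl fun i _ => Finset.sum_congr rfl fun j _ => by ring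
      have e5 : ∀ i j, l i * l j * inner ℝ (a i - a j) (b i - b j)
          = l i * l j * inner ℝ (a i) (b i) + l i * l j * inner ℝ (a j) (b j)
            - l i * l j * inner ℝ (a i) (b j) - l i * l j * inner ℝ (a j) (b i) := by
        intro i j
        simp only [inner_sub_left, inner_sub_right]; ring
      simp only [e5, Finset.sum_sub_distrib, Finset.sum_add_distrib, e1, e2, e3, e4]
      ring
    have h3 : ∑ i, l i • s i = (∑ i, l i • a i) + ∑ i, l i • b i := by
      simp only [hs, smul_add, Finset.sum_add_distrib]
    have h4 : 0 ≤ ‖(∑ i, l i • a i) - ∑ i, l i • b i‖ ^ 2 := by positivity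
    rw [norm_sub_sq_real] at h4
    simp only [hD, h3, norm_add_sq_real]
    linarith
  set w := ∑ i, l i • s i with hw
  refine ⟨(1 / 2 : ℝ) • w, fun i => ?_⟩
  -- First-order optimality of `l` in the direction of the vertex `i`; the quadratic remainder
  -- vanishes as `t → 0`.
  have hδ : inner ℝ (a i) (b i) - (∑ j, l j * inner ℝ (a j) (b j))
      - inner ℝ w (s i - w) / 2 ≤ 0 := by
    refine nonpos_of_forall_le_mul (C := ‖s i - w‖ ^ 2 / 4) (by positivity) fun t ht ht1 => ?_
    have hmem : (1 - t) • l + t • (Pi.single i 1 : ι → ℝ) ∈ stdSimplex ℝ ι :=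
      convex_stdSimplex ℝ ι hl (single_mem_stdSimplex ℝ i) (by linarith) ht.le (by ring)
    have h1 : D ((1 - t) • l + t • (Pi.single i 1 : ι → ℝ)) ≤ D l := hmax hmem
    have h2 : ∑ j, ((1 - t) • l + t • (Pi.single i 1 : ι → ℝ)) j * inner ℝ (a j) (b j)
        = (1 - t) * (∑ j, l j * inner ℝ (a j) (b j)) + t * inner ℝ (a i) (b i) := by
      simp [add_mul, Finset.sum_add_distrib, Pi.single_apply, Finset.mul_sum, mul_assoc]
    have h3 : ∑ j, ((1 - t) • l + t • (Pi.single i 1 : ι → ℝ)) j • s j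
        = w + t • (s i - w) := by
      have : ∑ j, ((1 - t) • l + t • (Pi.single i 1 : ι → ℝ)) j • s j
          = (1 - t) • w + t • s i := by
        simp [add_smul, Finset.sum_add_distrib, Pi.single_apply, hw, Finset.smul_sum, mul_smul]
      rw [this]; module
    simp only [hD, h2, h3] at h1
    rw [norm_add_sq_real, real_inner_smul_right, norm_smul, mul_pow, Real.norm_eq_abs,
      sq_abs] at h1
    refine le_of_mul_le_mul_left ?_ ht
    simp only [← hw] at h1
    linarith
  have hw2 : inner ℝ (a i - (1 / 2 : ℝ) • w) (b i - (1 / 2 : ℝ) • w)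
      = inner ℝ (a i) (b i) - inner ℝ w (s i) / 2 + ‖w‖ ^ 2 / 4 := by
    simp only [hs, inner_sub_left, inner_sub_right, inner_add_right, real_inner_smul_left,
      real_inner_smul_right, real_inner_comm w (a i), ← real_inner_self_eq_norm_sq]
    ring
  have hD' : (∑ j, l j * inner ℝ (a j) (b j)) - ‖w‖ ^ 2 / 4 ≤ 0 := hDle
  rw [inner_sub_right, real_inner_self_eq_norm_sq] at hδ
  rw [hw2]
  linarith

end Minty

variable {d : ℕ}

/-- **Minty's theorem**: the resolvents of a maximally monotone operator are defined everywhere. -/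
theorem IsMaximallyMonotone.exists_resolvent {G : SetOp d} (hG : IsMaximallyMonotone G) {c : ℝ}
    (hc : 0 < c) (x : E d) : ∃ y, ∃ u ∈ G y, x = y + c • u := by
  -- Such a `y` makes `(y, (x - y)/c)` monotonically related to the whole graph. Each condition
  -- defines a closed ball, so finitely many at a time suffice.
  obtain ⟨y, hy⟩ : ∃ y : E d, ∀ a u, u ∈ G a → inner ℝ (a - y) (x - c • u - y) ≤ 0 := by
    let I := {p : E d × E d // p.2 ∈ G p.1}
    let B : I → Set (E d) := fun p => {y | inner ℝ (p.1.1 - y) (x - c • p.1.2 - y) ≤ 0}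
    have hclosed : ∀ p, IsClosed (B p) := fun p =>
      isClosed_le (by fun_prop) continuous_const
    have hfin : ∀ t : Finset I, t.Nonempty → (⋂ i ∈ t, B i).Nonempty := by
      intro t ht
      have : Nonempty t := ht.to_subtype
      obtain ⟨y, hy⟩ := exists_common_point_of_antitone
        (fun i : t => i.1.1.1) (fun i : t => x - c • i.1.1.2) (by
          intro i j
          have h := hG.1 _ _ _ _ i.1.2 j.1.2
          have e : x - c • i.1.1.2 - (x - c • j.1.1.2) = (-c) • (i.1.1.2 - j.1.1.2) := by module
          rw [e, real_inner_smul_right, real_inner_comm]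
          nlinarith)
      exact ⟨y, Set.mem_iInter₂.2 fun i hi => hy ⟨i, hi⟩⟩
    by_cases hI : Nonempty I
    · obtain ⟨i₀⟩ := hI
      have hcomp : IsCompact (B i₀) := by
        refine Metric.isCompact_of_isClosed_isBounded (hclosed i₀) ?_
        refine (Metric.isBounded_closedBall (x := i₀.1.1)
          (r := ‖x - c • i₀.1.2 - i₀.1.1‖)).subset fun y hy => ?_
        have hy' : inner ℝ (i₀.1.1 - y) (x - c • i₀.1.2 - y) ≤ 0 := hy
        have e : x - c • i₀.1.2 - y = (x - c • i₀.1.2 - i₀.1.1) + (i₀.1.1 - y) := by abel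
        rw [e, inner_add_right, real_inner_self_eq_norm_sq] at hy'
        have h2 := neg_le_of_abs_le
          (abs_real_inner_le_norm (i₀.1.1 - y) (x - c • i₀.1.2 - i₀.1.1))
        rw [Metric.mem_closedBall, dist_eq_norm, norm_sub_rev]
        by_contra! hlt
        have := norm_nonneg (x - c • i₀.1.2 - i₀.1.1)
        nlinarith
      classical
      obtain ⟨y, -, hy⟩ := hcomp.inter_iInter_nonempty B hclosed (fun t => by
        obtain ⟨y, hy⟩ := hfin (insert i₀ t) (Finset.insert_nonempty _ _)
        rw [Set.mem_iInter₂] at hy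
        exact ⟨y, hy i₀ (Finset.mem_insert_self _ _), Set.mem_iInter₂.2 fun i hi =>
          hy i (Finset.mem_insert_of_mem hi)⟩)
      exact ⟨y, fun a u hu => Set.mem_iInter.1 hy ⟨(a, u), hu⟩⟩
    · exact ⟨0, fun a u hu => (hI ⟨⟨(a, u), hu⟩⟩).elim⟩
  set v : E d := c⁻¹ • (x - y) with hv
  have hcv : c • v = x - y := by rw [hv, smul_inv_smul₀ hc.ne']
  have hmono : ∀ a u, u ∈ G a → 0 ≤ inner ℝ (u - v) (a - y) := by
    intro a u hu
    have h := hy a u hu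
    have e : x - c • u - y = (-c) • (u - v) := by
      rw [smul_sub, neg_smul, neg_smul, hcv]; abel
    rw [e, real_inner_smul_right, real_inner_comm] at h
    nlinarith
  -- Adjoining `(y, v)` keeps the graph monotone, so by maximality it was already there.
  have heq := hG.2 (fun a => {u | u ∈ G a ∨ (a = y ∧ u = v)}) (by
    rintro a a' u u' (hu | ⟨rfl, rfl⟩) (hu' | ⟨rfl, rfl⟩)
    · exact hG.1 _ _ _ _ hu hu'
    · exact hmono _ _ hu
    · rw [← neg_sub u', ← neg_sub a', inner_neg_neg]; exact hmono _ _ hu'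
    · simp) (fun a u hu => Or.inl hu)
  refine ⟨y, v, ?_, by rw [hcv]; abel⟩
  rw [← heq]
  exact Or.inr ⟨rfl, rfl⟩

theorem resolventMap_spec {G : SetOp d} (hG : IsMaximallyMonotone G) {c : ℝ} (hc : 0 < c)
    (x : E d) : ∃ u ∈ G (resolventMap (smulOp c G) x),
      x = resolventMap (smulOp c G) x + c • u := by
  have hne : (setResolvent (smulOp c G) x).Nonempty := by
    obtain ⟨y, u, hu, hx⟩ := hG.exists_resolvent hc x
    exact ⟨y, c • u, ⟨u, hu, rfl⟩, hx⟩
  have h : resolventMap (smulOp c G) x ∈ setResolvent (smulOp c G) x := by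
    rw [resolventMap, dif_pos hne]; exact hne.some_mem
  obtain ⟨w, ⟨u, hu, rfl⟩, hx⟩ := h
  exact ⟨u, hu, hx⟩

theorem lipschitzWith_resolventMap {G : SetOp d} (hG : IsMaximallyMonotone G) {c : ℝ}
    (hc : 0 < c) : LipschitzWith 1 (resolventMap (smulOp c G)) := by
  refine LipschitzWith.of_dist_le_mul fun x x' => ?_
  obtain ⟨u, hu, hx⟩ := resolventMap_spec hG hc x
  obtain ⟨u', hu', hx'⟩ := resolventMap_spec hG hc x'
  have hm := hG.1 _ _ _ _ hu hu'
  set y := resolventMap (smulOp c G) x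
  set y' := resolventMap (smulOp c G) x'
  have e : x - x' = (y - y') + c • (u - u') := by rw [hx, hx']; module
  have h1 : ‖y - y'‖ ^ 2 ≤ inner ℝ (x - x') (y - y') := by
    rw [e, inner_add_left, real_inner_self_eq_norm_sq, real_inner_smul_left]
    nlinarith
  have h2 := real_inner_le_norm (x - x') (y - y')
  rw [NNReal.coe_one, one_mul, dist_eq_norm, dist_eq_norm]
  by_contra! hlt
  nlinarith [norm_nonneg (x - x')]

/-! ### The resolvent of `η(F+G)` -/

/-- The defining relation of `y = J_{η(F+G)} x`. -/
theorem mem_setResolvent_iff {F : E d → E d} {G : SetOp d} {η : ℝ} {x y : E d} :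
    y ∈ setResolvent (smulOp η (addOp F G)) x ↔ ∃ u ∈ G y, x = y + η • (F y + u) := by
  constructor
  · rintro ⟨_, ⟨_, ⟨u, hu, rfl⟩, rfl⟩, hx⟩
    exact ⟨u, hu, hx⟩
  · rintro ⟨u, hu, hx⟩
    exact ⟨_, ⟨_, ⟨u, hu, rfl⟩, rfl⟩, hx⟩

/-- The solution is the fixed point of `y ↦ J_{ηG}(x - η F y)`, an `ηL`-contraction because `J_{ηG}`
is nonexpansive. -/
theorem exists_resolvent_addOp {F : E d → E d} {G : SetOp d} {L : ℝ≥0} {η : ℝ}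
    (hF : LipschitzWith L F) (hG : IsMaximallyMonotone G) (hη : 0 < η) (hηL : η * L < 1)
    (x : E d) : ∃ y, ∃ u ∈ G y, x = y + η • (F y + u) := by
  let η' : ℝ≥0 := ⟨η, hη.le⟩
  have hlip : LipschitzWith (1 * (η' * L))
      (fun y => resolventMap (smulOp η G) (x - η • F y)) := by
    refine (lipschitzWith_resolventMap hG hη).comp (LipschitzWith.of_dist_le_mul fun y z => ?_)
    have e : x - η • F y - (x - η • F z) = (-η) • (F y - F z) := by module
    rw [dist_eq_norm, e, norm_smul, norm_neg, Real.norm_of_nonneg hη.le, NNReal.coe_mul,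
      mul_assoc, ← dist_eq_norm]
    exact mul_le_mul_of_nonneg_left (hF.dist_le_mul y z) hη.le
  have hcontr : ContractingWith (1 * (η' * L))
      (fun y => resolventMap (smulOp η G) (x - η • F y)) := by
    refine ⟨?_, hlip⟩
    rw [one_mul, ← NNReal.coe_lt_coe]
    exact hηL
  have hfix := hcontr.fixedPoint_isFixedPt
  set y := ContractingWith.fixedPoint _ hcontr
  obtain ⟨u, hu, hx⟩ := resolventMap_spec hG hη (x - η • F y)
  have hfix' : resolventMap (smulOp η G) (x - η • F y) = y := hfix
  rw [hfix'] at hu hx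
  refine ⟨y, u, hu, ?_⟩
  rw [smul_add, add_left_comm, ← hx]; abel

/-- The displacement `x - J_{η(F+G)} x` is `(1 - ρ/η)`-cocoercive. -/
theorem cocoercive_displacement {A : SetOp d} {ρ η : ℝ} (hA : IsCohypomonotone ρ A)
    (hη : 0 < η) {y y' u u' : E d} (hu : u ∈ A y) (hu' : u' ∈ A y') :
    (1 - ρ / η) * ‖η • u - η • u'‖ ^ 2 ≤
      inner ℝ (η • u - η • u') ((y + η • u) - (y' + η • u')) := by
  have h := hA _ _ _ _ hu hu'
  have e : (y + η • u) - (y' + η • u') = (y - y') + η • (u - u') := by module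
  rw [e, ← smul_sub, inner_add_right, real_inner_self_eq_norm_sq, real_inner_smul_left, norm_smul,
    Real.norm_of_nonneg hη.le]
  have e2 : (1 - ρ / η) * (η * ‖u - u'‖) ^ 2
      = (η * ‖u - u'‖) ^ 2 + η * (-ρ * ‖u - u'‖ ^ 2) := by
    field_simp; ring
  rw [e2]
  have := mul_le_mul_of_nonneg_left h hη.le
  linarith

theorem setResolvent_eq_singleton {F : E d → E d} {G : SetOp d} {ρ η : ℝ}
    (hA : IsCohypomonotone ρ (addOp F G)) (hη : 0 < η) (hρη : ρ < η) {x y u : E d}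
    (hu : u ∈ G y) (hx : x = y + η • (F y + u)) :
    setResolvent (smulOp η (addOp F G)) x = {y} := by
  refine Set.eq_singleton_iff_unique_mem.2 ⟨mem_setResolvent_iff.2 ⟨u, hu, hx⟩, fun z hz => ?_⟩
  obtain ⟨v, hv, hx'⟩ := mem_setResolvent_iff.1 hz
  have h := cocoercive_displacement hA hη (u := F y + u) (u' := F z + v) ⟨u, hu, rfl⟩ ⟨v, hv, rfl⟩
  rw [← hx, ← hx', sub_self, inner_zero_right] at h
  have hα : 0 < 1 - ρ / η := by rw [sub_pos, div_lt_one hη]; exact hρη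
  have h0 : ‖η • (F y + u) - η • (F z + v)‖ ^ 2 ≤ 0 := by
    by_contra! hlt
    nlinarith
  have h1 : η • (F y + u) - η • (F z + v) = 0 := by
    rw [← norm_eq_zero]; exact pow_eq_zero_iff (two_ne_zero) |>.1 (le_antisymm h0 (by positivity))
  have h2 : y + η • (F y + u) = z + η • (F z + v) := hx.symm.trans hx'
  rw [sub_eq_zero.1 h1] at h2
  exact (add_right_cancel h2).symm

/-! ### Linear convergence of the inner method -/

section ForwardBackwardForward

variable {V : Type*} [NormedAddCommGroup V] [InnerProductSpace ℝ V]

theorem three_add_div_le_exp {q : ℝ} (hq : 0 ≤ q) (hq1 : q ≤ 1) :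
    (3 + q) / (3 + 4 * q) ≤ Real.exp (-(q / 2)) := by
  have h := Real.abs_exp_sub_one_sub_id_le (x := q / 2) (by rw [abs_of_nonneg] <;> linarith)
  have h1 := (abs_le.1 h).2
  rw [Real.exp_neg, div_le_iff₀ (by linarith), ← div_eq_inv_mul, le_div_iff₀ (Real.exp_pos _)]
  have h2 : (3 + q) * Real.exp (q / 2) ≤ (3 + q) * (1 + q / 2 + (q / 2) ^ 2) :=
    mul_le_mul_of_nonneg_left (by linarith) (by linarith)
  have h3 : 0 ≤ q * (1 - q) * (6 + q) :=
    mul_nonneg (mul_nonneg hq (by linarith)) (by linarith)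
  nlinarith

/-- One forward-backward-forward step contracts the distance to the zero `s`; here `bz`, `bw`, `bs`
are the values of the forward operator at the points `z`, `w`, `s`. -/
theorem fbf_step_sq_le {z w s bz bw bs : V} {τ μ l q : ℝ} (hτ : 0 ≤ τ)
    (hmono : 0 ≤ inner ℝ (w - s) (z - τ • bz - w + τ • bs))
    (hstrong : μ * ‖w - s‖ ^ 2 ≤ inner ℝ (w - s) (bw - bs))
    (hlip : ‖bz - bw‖ ≤ l * ‖z - w‖) (hτl : τ * l = 1 / 2) (hq : 2 * (τ * μ) = q)
    (hq0 : 0 ≤ q) (hq1 : q ≤ 1) :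
    ‖w + τ • bz - τ • bw - s‖ ^ 2 ≤ Real.exp (-(q / 2)) * ‖z - s‖ ^ 2 := by
  have hc : ‖τ • (bz - bw)‖ ^ 2 ≤ 1 / 4 * ‖z - w‖ ^ 2 := by
    have h1 : ‖τ • (bz - bw)‖ ≤ 1 / 2 * ‖z - w‖ := by
      rw [norm_smul, Real.norm_of_nonneg hτ, ← hτl, mul_assoc]
      exact mul_le_mul_of_nonneg_left hlip hτ
    calc ‖τ • (bz - bw)‖ ^ 2 ≤ (1 / 2 * ‖z - w‖) ^ 2 := by gcongr
      _ = _ := by ring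
  have e1 : w + τ • bz - τ • bw - s = (w - s) + τ • (bz - bw) := by module
  have e2 : z - s = (w - s) + (z - w) := by abel
  have e3 : inner ℝ (w - s) (z - τ • bz - w + τ • bs)
      = inner ℝ (w - s) (z - w) - inner ℝ (w - s) (τ • (bz - bw))
        - τ * inner ℝ (w - s) (bw - bs) := by
    rw [← real_inner_smul_right, ← inner_sub_right, ← inner_sub_right]
    congr 1; module
  have hdesc : ‖w + τ • bz - τ • bw - s‖ ^ 2
      ≤ ‖z - s‖ ^ 2 - 3 / 4 * ‖z - w‖ ^ 2 - q * ‖w - s‖ ^ 2 := by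
    have h2 := mul_le_mul_of_nonneg_left hstrong hτ
    rw [e1, e2, norm_add_sq_real, norm_add_sq_real, ← hq]
    rw [e3] at hmono
    linarith
  have htri : ‖z - s‖ ≤ ‖z - w‖ + ‖w - s‖ := norm_sub_le_norm_sub_add_norm_sub _ _ _
  have hsq : ‖z - s‖ ^ 2 ≤ (‖z - w‖ + ‖w - s‖) ^ 2 := by gcongr
  have h4 : 3 * q * ‖z - s‖ ^ 2
      ≤ (3 + 4 * q) * (3 / 4 * ‖z - w‖ ^ 2 + q * ‖w - s‖ ^ 2) := by
    have h5 := mul_le_mul_of_nonneg_left hsq (by positivity : 0 ≤ 3 * q)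
    -- After the triangle inequality, the gap is exactly this square: `3q/(3+4q)` is the best
    -- constant.
    nlinarith [sq_nonneg (3 / 2 * ‖z - w‖ - 2 * q * ‖w - s‖)]
  refine le_trans ?_ (mul_le_mul_of_nonneg_right (three_add_div_le_exp hq0 hq1) (sq_nonneg _))
  rw [div_mul_eq_mul_div, le_div_iff₀ (by positivity)]
  have h6 := mul_le_mul_of_nonneg_right hdesc (by positivity : 0 ≤ 3 + 4 * q)
  linarith

end ForwardBackwardForward

theorem approxResolvent_val_succ (F : E d → E d) (G : SetOp d) (η L : ℝ) (x : E d) (t : ℕ) :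
    (approxResolvent F G η L x (t + 1)).val =
      let τ : ℝ := 1 / (2 * (1 + η * L))
      let z := (approxResolvent F G η L x t).val
      let w := resolventMap (smulOp (τ * η) G) (z - τ • (z + η • F z - x))
      w + τ • (z + η • F z - x) - τ • (w + η • F w - x) := rfl

theorem approxResolvent_counts (F : E d → E d) (G : SetOp d) (η L : ℝ) (x : E d) (t : ℕ) :
    (approxResolvent F G η L x t).evals = 2 * t ∧
      (approxResolvent F G η L x t).resolvents = t := by
  induction t with
  | zero => exact ⟨rfl, rfl⟩
  | succ t ih =>
    have h1 : (approxResolvent F G η L x (t + 1)).evals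
        = (approxResolvent F G η L x t).evals + (1 + 0 + (0 + (1 + 0 + 0))) := rfl
    have h2 : (approxResolvent F G η L x (t + 1)).resolvents
        = (approxResolvent F G η L x t).resolvents + (0 + 0 + (1 + (0 + 0 + 0))) := rfl
    omega

theorem approxResolvent_sq_le {F : E d → E d} {G : SetOp d} {L : ℝ≥0} {η : ℝ}
    (hF : LipschitzWith L F) (hG : IsMaximallyMonotone G) (hη : 0 < η) (hηL : η * L < 1)
    {x y u : E d} (hu : u ∈ G y) (hx : x = y + η • (F y + u)) (t : ℕ) :
    ‖(approxResolvent F G η L x t).val - y‖ ^ 2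
      ≤ Real.exp (-((1 - η * L) / (1 + η * L) / 2)) ^ t * ‖x - y‖ ^ 2 := by
  have hηL0 : 0 ≤ η * L := mul_nonneg hη.le L.2
  induction t with
  | zero => rw [pow_zero, one_mul]; exact le_rfl
  | succ t ih =>
    rw [pow_succ' (Real.exp _), mul_assoc]
    refine le_trans ?_ (mul_le_mul_of_nonneg_left ih (Real.exp_pos _).le)
    rw [approxResolvent_val_succ]
    set z := (approxResolvent F G η L x t).val
    set τ : ℝ := 1 / (2 * (1 + η * L)) with hτ
    have hτ0 : 0 < τ := by positivity
    obtain ⟨v, hv, hw⟩ := resolventMap_spec hG (mul_pos hτ0 hη) (z - τ • (z + η • F z - x))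
    dsimp only
    set w := resolventMap (smulOp (τ * η) G) (z - τ • (z + η • F z - x))
    refine fbf_step_sq_le (bs := y + η • F y - x) (μ := 1 - η * L) (l := 1 + η * L)
      hτ0.le ?_ ?_ ?_ ?_ ?_ ?_ ?_
    -- Monotonicity of `G` between `w` and the exact solution `y`, at which the forward operator
    -- equals `-η u`.
    · have e : z - τ • (z + η • F z - x) - w + τ • (y + η • F y - x)
          = (τ * η) • (v - u) := by
        rw [hw, hx]; module
      rw [e, real_inner_smul_right, real_inner_comm]
      exact mul_nonneg (mul_pos hτ0 hη).le (hG.1 _ _ _ _ hv hu)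
    · have e : w + η • F w - x - (y + η • F y - x) = (w - y) + η • (F w - F y) := by module
      rw [e, inner_add_right, real_inner_self_eq_norm_sq, real_inner_smul_right]
      have h1 := neg_le_of_abs_le (abs_real_inner_le_norm (w - y) (F w - F y))
      have h2 : ‖F w - F y‖ ≤ L * ‖w - y‖ := by
        rw [← dist_eq_norm, ← dist_eq_norm]; exact hF.dist_le_mul _ _
      have h3 := mul_le_mul_of_nonneg_left h2 (norm_nonneg (w - y))
      have h4 : -(‖w - y‖ * (L * ‖w - y‖)) ≤ inner ℝ (w - y) (F w - F y) := by linarith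
      have h5 := mul_le_mul_of_nonneg_left h4 hη.le
      linarith
    · have e : z + η • F z - x - (w + η • F w - x) = (z - w) + η • (F z - F w) := by module
      rw [e]
      refine (norm_add_le _ _).trans ?_
      have h2 : ‖F z - F w‖ ≤ L * ‖z - w‖ := by
        rw [← dist_eq_norm, ← dist_eq_norm]; exact hF.dist_le_mul _ _
      rw [norm_smul, Real.norm_of_nonneg hη.le]
      have := mul_le_mul_of_nonneg_left h2 hη.le
      linarith
    · rw [hτ]; field_simp
    · rw [hτ]; field_simp
    · exact div_nonneg (by linarith) (by linarith)
    · rw [div_le_one (by linarith)]; linarith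

/-- The relative accuracy that the inner method reaches at outer iteration `k`. -/
noncomputable def innerAccuracy (k : ℕ) : ℝ :=
  1 / (98 * Real.sqrt ((k : ℝ) + 2) * Real.log ((k : ℝ) + 2))

theorem log_two_le_log_add_two (k : ℕ) : Real.log 2 ≤ Real.log ((k : ℝ) + 2) :=
  Real.log_le_log two_pos (by linarith [(Nat.cast_nonneg k : (0 : ℝ) ≤ k)])

theorem log_add_two_pos (k : ℕ) : 0 < Real.log ((k : ℝ) + 2) :=
  (Real.log_pos one_lt_two).trans_le (log_two_le_log_add_two k)

theorem innerAccuracy_pos (k : ℕ) : 0 < innerAccuracy k := by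
  have := log_add_two_pos k
  unfold innerAccuracy; positivity

/-- With `q = (1-ηL)/(1+ηL)`, each step multiplies the bound on the squared error by `exp(-q/2)`;
hence `(4/q) log(1/δ)` steps give `δ²`. -/
theorem approxResolvent_innerIterations {F : E d → E d} {G : SetOp d} {L : ℝ≥0} {η : ℝ}
    (hF : LipschitzWith L F) (hG : IsMaximallyMonotone G) (hη : 0 < η) (hηL : η * L < 1)
    {x y u : E d} (hu : u ∈ G y) (hx : x = y + η • (F y + u)) (k : ℕ) :
    ‖(approxResolvent F G η L x (innerIterations η L k)).val - y‖
      ≤ innerAccuracy k * ‖x - y‖ := by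
  have hηL0 : 0 ≤ η * L := mul_nonneg hη.le L.2
  have hM := innerAccuracy_pos k
  refine le_of_sq_le_sq ?_ (by positivity)
  refine (approxResolvent_sq_le hF hG hη hηL hu hx _).trans ?_
  rw [mul_pow]
  refine mul_le_mul_of_nonneg_right ?_ (sq_nonneg _)
  have hN : 4 * (1 + η * L) / (1 - η * L) *
      Real.log (98 * Real.sqrt ((k : ℝ) + 2) * Real.log ((k : ℝ) + 2))
      ≤ innerIterations η L k := Nat.le_ceil _
  have hlog : Real.log (innerAccuracy k)
      = -Real.log (98 * Real.sqrt ((k : ℝ) + 2) * Real.log ((k : ℝ) + 2)) := by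
    rw [innerAccuracy, one_div, Real.log_inv]
  rw [← Real.exp_nat_mul, ← Real.exp_log (pow_pos hM 2), Real.log_pow, hlog]
  refine Real.exp_le_exp.2 ?_
  set l := Real.log (98 * Real.sqrt ((k : ℝ) + 2) * Real.log ((k : ℝ) + 2))
  have h1 : 0 < 1 - η * L := by linarith
  have h2 : 0 < 1 + η * L := by linarith
  have h3 : 0 ≤ (1 - η * L) / (1 + η * L) / 2 := by positivity
  have h4 := mul_le_mul_of_nonneg_right hN h3
  have h5 : 4 * (1 + η * L) / (1 - η * L) * l * ((1 - η * L) / (1 + η * L) / 2) = 2 * l := by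
    field_simp; ring
  rw [h5] at h4
  push_cast
  linarith

/-! ### Inexact Halpern iteration -/

section Halpern

variable {V : Type*} [NormedAddCommGroup V] [InnerProductSpace ℝ V]

/-- For `s = x^(1/4)`: `log x = 4 log s ≤ 4s - 4 ≤ s²`. -/
theorem log_le_sqrt {x : ℝ} (hx : 0 < x) : Real.log x ≤ Real.sqrt x := by
  have hs : 0 < Real.sqrt (Real.sqrt x) := Real.sqrt_pos.2 (Real.sqrt_pos.2 hx)
  have h1 := Real.log_le_sub_one_of_pos hs
  rw [Real.log_sqrt (Real.sqrt_nonneg _), Real.log_sqrt hx.le] at h1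
  nlinarith [Real.sq_sqrt (Real.sqrt_nonneg x), sq_nonneg (Real.sqrt (Real.sqrt x) - 2)]

/-- Each later term is at most `1/log m - 1/log(m+1)` for the previous `m`, so the sum telescopes.
This convergence is what the factor `log(k+2)` in `N_k` buys. -/
theorem sum_range_inv_mul_log_sq_le (n : ℕ) :
    ∑ j ∈ Finset.range n, 1 / (((j : ℝ) + 2) * Real.log ((j : ℝ) + 2) ^ 2) ≤ 3 := by
  have key : ∀ n : ℕ, ∑ j ∈ Finset.range (n + 1),
      1 / (((j : ℝ) + 2) * Real.log ((j : ℝ) + 2) ^ 2) ≤ 3 - 1 / Real.log ((n : ℝ) + 2) := by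
    intro n
    induction n with
    | zero =>
      have h := Real.log_two_gt_d9
      simp only [zero_add, Finset.sum_range_one, Nat.cast_zero]
      rw [← sub_nonneg]
      have e : 3 - 1 / Real.log 2 - 1 / (2 * Real.log 2 ^ 2)
          = (6 * Real.log 2 ^ 2 - 2 * Real.log 2 - 1) / (2 * Real.log 2 ^ 2) := by
        field_simp; ring
      rw [e]
      exact div_nonneg (by nlinarith) (by positivity)
    | succ n ih =>
      rw [Finset.sum_range_succ]
      have ha := log_add_two_pos n
      have hb := log_add_two_pos (n + 1)
      push_cast at hb ⊢
      have e0 : (n : ℝ) + 1 + 2 = n + 3 := by ring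
      rw [e0] at hb ⊢
      have hab : 1 / ((n : ℝ) + 3) ≤ Real.log ((n : ℝ) + 3) - Real.log ((n : ℝ) + 2) := by
        have h := Real.log_le_sub_one_of_pos
          (x := ((n : ℝ) + 2) / ((n : ℝ) + 3)) (by positivity)
        rw [Real.log_div (by positivity) (by positivity)] at h
        have e : ((n : ℝ) + 2) / ((n : ℝ) + 3) - 1 = -(1 / ((n : ℝ) + 3)) := by
          field_simp; ring
        linarith
      have hle : Real.log ((n : ℝ) + 2) ≤ Real.log ((n : ℝ) + 3) :=
        Real.log_le_log (by positivity) (by linarith)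
      set a := Real.log ((n : ℝ) + 2)
      set b := Real.log ((n : ℝ) + 3)
      have h1 : 1 / (((n : ℝ) + 3) * b ^ 2) ≤ 1 / a - 1 / b := by
        have e1 : 1 / (((n : ℝ) + 3) * b ^ 2) = 1 / ((n : ℝ) + 3) / b ^ 2 := by field_simp
        have e2 : 1 / a - 1 / b = (b - a) / (a * b) := by field_simp
        rw [e1, e2]
        have h2 : a * b ≤ b ^ 2 := by nlinarith
        exact (div_le_div_of_nonneg_right hab (by positivity)).trans
          (div_le_div_of_nonneg_left (by linarith) (by positivity) h2)
      linarith
  have hpos : ∀ j : ℕ, 0 ≤ 1 / (((j : ℝ) + 2) * Real.log ((j : ℝ) + 2) ^ 2) := fun j => by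
    positivity
  have h1 := key n
  rw [Finset.sum_range_succ] at h1
  have h2 := hpos n
  have h3 : 0 < 1 / Real.log ((n : ℝ) + 2) := one_div_pos.2 (log_add_two_pos n)
  linarith

/-- The potential of the Halpern iteration with displacements `p` and errors `e` grows in one step
only by terms of the size of the error. -/
theorem halpern_potential_step {x₀ y y' p p' e : V} {n : ℝ} (hn : 0 < n)
    (hstep : y' = (1 / (n + 1)) • x₀ + (1 - 1 / (n + 1)) • (y - p + e))
    (hcoc : ‖p' - p‖ ^ 2 ≤ inner ℝ (p' - p) (y' - y)) :
    n * (n + 1) / 2 * ‖p'‖ ^ 2 + (n + 1) * inner ℝ p' (y' - x₀)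
      ≤ (n - 1) * n / 2 * ‖p‖ ^ 2 + n * inner ℝ p (y - x₀)
        + (n * (n + 1) / 2 * ‖e‖ ^ 2 + n * (‖p‖ * ‖e‖)) := by
  have hs : (n + 1) • (y' - x₀) = n • (y - x₀ - p + e) := by
    have h1 : (n + 1) • y' = x₀ + n • (y - p + e) := by
      rw [hstep, smul_add, smul_smul, smul_smul, mul_one_div_cancel (by positivity), one_smul]
      congr 2; field_simp; ring
    rw [smul_sub, h1]; module
  -- The step is written in two ways, so that pairing with `p'` and with `p` produces the inner
  -- products of the new and the old potential.
  have hy1 : n • (y' - y) = -(y' - x₀) - n • p + n • e := by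
    have : n • (y' - y) = (n + 1) • (y' - x₀) - (y' - x₀) - n • (y - x₀) := by module
    rw [this, hs]; module
  have hy2 : (n + 1) • (y' - y) = -(y - x₀) - n • p + n • e := by
    have : (n + 1) • (y' - y) = (n + 1) • (y' - x₀) - (n + 1) • (y - x₀) := by module
    rw [this, hs]; module
  have i1 : n * inner ℝ p' (y' - y)
      = -inner ℝ p' (y' - x₀) - n * inner ℝ p' p + n * inner ℝ p' e := by
    rw [← real_inner_smul_right, hy1, inner_add_right, inner_sub_right, inner_neg_right,
      real_inner_smul_right, real_inner_smul_right]
  have i2 : (n + 1) * inner ℝ p (y' - y)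
      = -inner ℝ p (y - x₀) - n * ‖p‖ ^ 2 + n * inner ℝ p e := by
    rw [← real_inner_smul_right, hy2, inner_add_right, inner_sub_right, inner_neg_right,
      real_inner_smul_right, real_inner_smul_right, real_inner_self_eq_norm_sq]
  have hpp : ‖p' - p‖ ^ 2 = ‖p'‖ ^ 2 - 2 * inner ℝ p' p + ‖p‖ ^ 2 := norm_sub_sq_real _ _
  have hyoung : 2 * inner ℝ (p' - p) e ≤ ‖p' - p‖ ^ 2 + ‖e‖ ^ 2 := by
    have h := sq_nonneg ‖p' - p - e‖
    rw [norm_sub_sq_real] at h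
    linarith
  rw [inner_sub_left] at hyoung hcoc
  have hpe := real_inner_le_norm p e
  have h1 := mul_le_mul_of_nonneg_left hcoc (by positivity : 0 ≤ n * (n + 1))
  have h2 := mul_le_mul_of_nonneg_left hyoung (by positivity : 0 ≤ n * (n + 1) / 2)
  have h3 := mul_le_mul_of_nonneg_left hpe hn.le
  have h4 : n * (n + 1) * (inner ℝ p' (y' - y) - inner ℝ p (y' - y))
      = (n + 1) * (-inner ℝ p' (y' - x₀) - n * inner ℝ p' p + n * inner ℝ p' e)
        - n * (-inner ℝ p (y - x₀) - n * ‖p‖ ^ 2 + n * inner ℝ p e) := by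
    rw [← i1, ← i2]; ring
  rw [h4] at h1
  rw [hpp] at h1 h2
  linarith

/-- The constant 98 enters through `16/98 + 8/98² ≤ 1/6`; as the series is at most 3, all errors
together cost at most `D²/2`. -/
theorem halpern_error_le {a ε D : ℝ} (k : ℕ) (ha : 0 ≤ a) (hε : 0 ≤ ε)
    (haD : a ≤ 4 * D / ((k : ℝ) + 2)) (hεa : ε ≤ innerAccuracy k * a) :
    ((k : ℝ) + 1) * ((k : ℝ) + 2) / 2 * ε ^ 2 + ((k : ℝ) + 1) * (a * ε)
      ≤ D ^ 2 / 6 * (1 / (((k : ℝ) + 2) * Real.log ((k : ℝ) + 2) ^ 2)) := by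
  have hl := log_add_two_pos k
  have hm : (0 : ℝ) < (k : ℝ) + 2 := by positivity
  have hδ := innerAccuracy_pos k
  have hls := log_le_sqrt hm
  have hδdef : innerAccuracy k
    = 1 / (98 * Real.sqrt ((k : ℝ) + 2) * Real.log ((k : ℝ) + 2)) := rfl
  have hk : (k : ℝ) + 1 ≤ (k : ℝ) + 2 := by linarith
  have hk0 : (0 : ℝ) ≤ (k : ℝ) + 1 := by positivity
  set m : ℝ := (k : ℝ) + 2
  set n : ℝ := (k : ℝ) + 1
  set l := Real.log m
  set δ := innerAccuracy k
  have hs : 0 < Real.sqrt m := Real.sqrt_pos.2 hm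
  have hss := Real.sq_sqrt hm.le
  set s := Real.sqrt m
  have hma : m * a ≤ 4 * D := by rwa [le_div_iff₀ hm, mul_comm] at haD
  have hD : 0 ≤ D := by nlinarith
  have hma2 : m ^ 2 * a ^ 2 ≤ 16 * D ^ 2 := by
    calc m ^ 2 * a ^ 2 = (m * a) ^ 2 := by ring
      _ ≤ (4 * D) ^ 2 := by gcongr
      _ = _ := by ring
  have hδ2 : δ ^ 2 = 1 / 9604 * (1 / (m * l ^ 2)) := by
    rw [hδdef, ← hss]; field_simp; norm_num
  have hδm : δ / m ≤ 1 / 98 * (1 / (m * l ^ 2)) := by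
    have e1 : δ / m = 1 / 98 * (1 / (m * (l * s))) := by
      rw [hδdef]; field_simp
    rw [e1]
    gcongr
    rw [sq]; gcongr
  have t1 : n * m / 2 * ε ^ 2 ≤ 8 * D ^ 2 * δ ^ 2 := by
    calc n * m / 2 * ε ^ 2 ≤ m * m / 2 * (δ * a) ^ 2 := by gcongr
      _ = (m ^ 2 * a ^ 2) * δ ^ 2 / 2 := by ring
      _ ≤ (16 * D ^ 2) * δ ^ 2 / 2 := by gcongr
      _ = _ := by ring
  have t2 : n * (a * ε) ≤ 16 * D ^ 2 * (δ / m) := by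
    calc n * (a * ε) ≤ m * (a * (δ * a)) := by gcongr
      _ = (m ^ 2 * a ^ 2) * (δ / m) := by field_simp
      _ ≤ _ := by gcongr
  set r := 1 / (m * l ^ 2)
  have hr : 0 ≤ D ^ 2 * r := by positivity
  have t3 : 16 * D ^ 2 * (δ / m) ≤ 16 * D ^ 2 * (1 / 98 * r) := by gcongr
  rw [hδ2] at t1
  linarith

/-- Inexact Halpern iteration of a firmly nonexpansive map with displacements `p` and errors `e`. -/
theorem halpern_displacement_le {x p e : ℕ → V} {s : V}
    (hstep : ∀ k : ℕ, x (k + 1) = (1 / ((k : ℝ) + 2)) • x 0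
      + (1 - 1 / ((k : ℝ) + 2)) • (x k - p k + e k))
    (hcoc : ∀ j k, ‖p j - p k‖ ^ 2 ≤ inner ℝ (p j - p k) (x j - x k))
    (hsol : ∀ k, ‖p k‖ ^ 2 ≤ inner ℝ (p k) (x k - s))
    (herr : ∀ k, ‖e k‖ ≤ innerAccuracy k * ‖p k‖) (k : ℕ) :
    ‖p k‖ ≤ 4 * ‖x 0 - s‖ / ((k : ℝ) + 2) := by
  set D := ‖x 0 - s‖ with hD
  set R : ℕ → ℝ := fun k =>
    ∑ j ∈ Finset.range k, 1 / (((j : ℝ) + 2) * Real.log ((j : ℝ) + 2) ^ 2) with hR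
  set W : ℕ → ℝ := fun k =>
    (k : ℝ) * ((k : ℝ) + 1) / 2 * ‖p k‖ ^ 2 + ((k : ℝ) + 1) * inner ℝ (p k) (x k - x 0) with hW
  -- The induction is on the potential; at each stage this turns it into the bound on `‖p k‖` that
  -- controls the next error.
  have hbound : ∀ k, W k ≤ D ^ 2 / 6 * R k → ‖p k‖ ≤ 4 * D / ((k : ℝ) + 2) := by
    intro k hk
    have h3 : W k ≤ D ^ 2 / 2 := by
      have := mul_le_mul_of_nonneg_left (sum_range_inv_mul_log_sq_le k)
        (by positivity : 0 ≤ D ^ 2 / 6)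
      simp only [hR] at hk
      linarith
    have h4 : ‖p k‖ ^ 2 - ‖p k‖ * D ≤ inner ℝ (p k) (x k - x 0) := by
      have e1 : x k - x 0 = (x k - s) - (x 0 - s) := by abel
      rw [e1, inner_sub_right]
      linarith [hsol k, real_inner_le_norm (p k) (x 0 - s)]
    have h5 := mul_le_mul_of_nonneg_left h4 (by positivity : (0 : ℝ) ≤ (k : ℝ) + 1)
    simp only [hW] at h3
    rw [le_div_iff₀ (by positivity)]
    by_contra! hlt
    have hD0 : 0 ≤ D := norm_nonneg _
    have ha : 0 ≤ ‖p k‖ := norm_nonneg _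
    have hk0 : (0 : ℝ) ≤ k := Nat.cast_nonneg k
    set a := ‖p k‖
    have h6 : ((k : ℝ) + 1) * (a * (a * (k + 2)) - 2 * (a * D)) ≤ D ^ 2 := by nlinarith
    have ha' : 0 < a := by
      by_contra! h0
      have : a = 0 := le_antisymm h0 ha
      rw [this] at hlt
      linarith
    have h7 : a * (4 * D) ≤ a * (a * (k + 2)) := mul_le_mul_of_nonneg_left hlt.le ha
    have h9 : ((k : ℝ) + 1) * (a * (a * (k + 2)) / 2) ≤ D ^ 2 := by
      refine le_trans ?_ h6
      exact mul_le_mul_of_nonneg_left (by linarith) (by positivity)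
    have h10 : (4 * D) ^ 2 < (a * (k + 2)) ^ 2 := by gcongr
    have h11 : (a * (k + 2)) ^ 2 ≤ 4 * (((k : ℝ) + 1) * (a * (a * (k + 2)) / 2)) := by
      have : 4 * (((k : ℝ) + 1) * (a * (a * (k + 2)) / 2)) - (a * (k + 2)) ^ 2
          = a ^ 2 * (k + 2) * k := by ring
      have : 0 ≤ a ^ 2 * (k + 2) * k := by positivity
      linarith
    nlinarith
  refine hbound k ?_
  induction k with
  | zero => simp [hW, hR]
  | succ k ih =>
    have h := halpern_potential_step (x₀ := x 0) (y := x k) (y' := x (k + 1)) (p := p k)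
      (p' := p (k + 1)) (e := e k) (n := (k : ℝ) + 1) (by positivity)
      (by rw [hstep k]; ring_nf) (hcoc _ _)
    have h2 := halpern_error_le k (norm_nonneg (p k)) (norm_nonneg (e k)) (hbound k ih) (herr k)
    have e1 : R (k + 1) = R k + 1 / (((k : ℝ) + 2) * Real.log ((k : ℝ) + 2) ^ 2) :=
      Finset.sum_range_succ _ _
    rw [e1, mul_add]
    have e2 : (k : ℝ) + 1 + 1 = k + 2 := by ring
    simp only [hW] at ih ⊢
    push_cast
    rw [e2] at h ⊢
    rw [add_sub_cancel_right] at h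
    linarith

end Halpern

/-! ### Residual and oracle complexity of the algorithm -/

theorem halpern_val_succ (F : E d → E d) (G : SetOp d) (η L ρ : ℝ) (x₀ : E d) (k : ℕ) :
    (halpern F G η L ρ x₀ (k + 1)).val =
      let x := (halpern F G η L ρ x₀ k).val
      (1 / ((k : ℝ) + 2)) • x₀ + (1 - 1 / ((k : ℝ) + 2)) •
        ((1 - (1 - ρ / η)) • x + (1 - ρ / η) •
          (approxResolvent F G η L x (innerIterations η L k)).val) := rfl

theorem halpern_oracleCalls (F : E d → E d) (G : SetOp d) (η L ρ : ℝ) (x₀ : E d) (k : ℕ) :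
    (halpern F G η L ρ x₀ k).oracleCalls = ∑ j ∈ Finset.range k, 2 * innerIterations η L j := by
  have key : (halpern F G η L ρ x₀ k).evals
        = ∑ j ∈ Finset.range k, 2 * innerIterations η L j ∧
      (halpern F G η L ρ x₀ k).resolvents = ∑ j ∈ Finset.range k, innerIterations η L j := by
    induction k with
    | zero => exact ⟨rfl, rfl⟩
    | succ k ih =>
      have h1 : (halpern F G η L ρ x₀ (k + 1)).evals = (halpern F G η L ρ x₀ k).evals +
        ((approxResolvent F G η L (halpern F G η L ρ x₀ k).val
          (innerIterations η L k)).evals + 0) := rfl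
      have h2 : (halpern F G η L ρ x₀ (k + 1)).resolvents = (halpern F G η L ρ x₀ k).resolvents +
        ((approxResolvent F G η L (halpern F G η L ρ x₀ k).val
          (innerIterations η L k)).resolvents + 0) := rfl
      rw [h1, h2, (approxResolvent_counts ..).1, (approxResolvent_counts ..).2,
        Finset.sum_range_succ, Finset.sum_range_succ, ih.1, ih.2]
      exact ⟨rfl, rfl⟩
  rw [Counted.oracleCalls, key.1, key.2]
  exact max_eq_left (Finset.sum_le_sum fun j _ => by omega)

/-- The residual of the inexact Halpern iterates. -/
theorem halpern_residual_le {F : E d → E d} {G : SetOp d} {L : ℝ≥0} {ρ η : ℝ}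
    (hF : LipschitzWith L F) (hG : IsMaximallyMonotone G)
    (hA : IsCohypomonotone ρ (addOp F G)) (hη : 0 < η) (hρη : ρ < η) (hηL : η * L < 1)
    {x₀ s : E d} (hs : 0 ∈ addOp F G s) (k : ℕ) :
    ∃ y, setResolvent (smulOp η (addOp F G)) (halpern F G η L ρ x₀ k).val = {y} ∧
      (1 - ρ / η) * ‖(halpern F G η L ρ x₀ k).val - y‖ ≤ 4 * ‖x₀ - s‖ / ((k : ℝ) + 2) := by
  set α := 1 - ρ / η with hαdef
  have hα : 0 < α := by rw [hαdef, sub_pos, div_lt_one hη]; exact hρη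
  set x : ℕ → E d := fun k => (halpern F G η L ρ x₀ k).val with hx
  choose y u hu hxy using fun k => exists_resolvent_addOp hF hG hη hηL (x k)
  have hsub : ∀ k, x k - y k = η • (F (y k) + u k) := fun k => by
    rw [sub_eq_iff_eq_add']; exact hxy k
  have hscale : ∀ {v w : E d}, α * ‖v‖ ^ 2 ≤ inner ℝ v w → ‖α • v‖ ^ 2 ≤ inner ℝ (α • v) w := by
    intro v w h
    rw [norm_smul, Real.norm_of_nonneg hα.le, real_inner_smul_left]
    nlinarith
  refine ⟨y k, setResolvent_eq_singleton hA hη hρη (hu k) (hxy k), ?_⟩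
  have h := halpern_displacement_le (x := x) (p := fun k => α • (x k - y k))
    (e := fun k => α • ((approxResolvent F G η L (x k) (innerIterations η L k)).val - y k))
    (s := s) ?_ ?_ ?_ ?_ k
  · rw [norm_smul, Real.norm_of_nonneg hα.le] at h
    exact h
  · intro k
    have e0 : x k - α • (x k - y k)
        + α • ((approxResolvent F G η L (x k) (innerIterations η L k)).val - y k)
        = (1 - α) • x k + α • (approxResolvent F G η L (x k) (innerIterations η L k)).val := by
      module
    rw [e0]
    exact halpern_val_succ F G η L ρ x₀ k
  · intro j k
    have h := cocoercive_displacement hA hη (u := F (y j) + u j) (u' := F (y k) + u k)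
      ⟨_, hu j, rfl⟩ ⟨_, hu k, rfl⟩
    rw [← hxy, ← hxy, ← hsub, ← hsub] at h
    have h' := hscale h
    rwa [smul_sub] at h'
  -- The solution `s` is its own resolvent value, with displacement zero.
  · intro k
    have h := cocoercive_displacement hA hη (u := F (y k) + u k) (u' := 0)
      ⟨_, hu k, rfl⟩ hs
    rw [← hxy, ← hsub, smul_zero, sub_zero, add_zero] at h
    exact hscale h
  · intro k
    simp only [norm_smul, Real.norm_of_nonneg hα.le]
    have := mul_le_mul_of_nonneg_left
      (approxResolvent_innerIterations hF hG hη hηL (hu k) (hxy k) k) hα.le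
    linarith

theorem innerIterations_le {η L : ℝ} (h0 : 0 ≤ η * L) (h1 : η * L < 1) (k : ℕ) :
    (innerIterations η L k : ℝ) ≤
      (1 + η * L) / (1 - η * L) * (4 * Real.log 98 + 8 * Real.log ((k : ℝ) + 2) + 1) := by
  have hl := log_add_two_pos k
  have hm : (0 : ℝ) < (k : ℝ) + 2 := by positivity
  have hκ : 1 ≤ (1 + η * L) / (1 - η * L) := by
    rw [le_div_iff₀ (by linarith)]; linarith
  have hM : Real.log (98 * Real.sqrt ((k : ℝ) + 2) * Real.log ((k : ℝ) + 2))
      ≤ Real.log 98 + 2 * Real.log ((k : ℝ) + 2) := by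
    have hs : 0 < Real.sqrt ((k : ℝ) + 2) := Real.sqrt_pos.2 hm
    rw [Real.log_mul (by positivity) hl.ne', Real.log_mul (by norm_num) hs.ne',
      Real.log_sqrt hm.le]
    have h2 : Real.log (Real.log ((k : ℝ) + 2)) ≤ Real.log ((k : ℝ) + 2) :=
      (Real.log_le_sub_one_of_pos hl).trans (by linarith)
    linarith
  -- The ceiling is a natural number, so bounding it by its argument plus one needs a nonnegative
  -- argument.
  have hM0 : 0 ≤ Real.log (98 * Real.sqrt ((k : ℝ) + 2) * Real.log ((k : ℝ) + 2)) := by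
    refine Real.log_nonneg ?_
    have h2 : 1 ≤ Real.sqrt ((k : ℝ) + 2) := Real.one_le_sqrt.2 (by linarith)
    have h3 : 1 / 2 ≤ Real.log ((k : ℝ) + 2) := by
      linarith [log_two_le_log_add_two k, Real.log_two_gt_d9]
    nlinarith
  have hc : 0 ≤ 4 * (1 + η * L) / (1 - η * L) := div_nonneg (by linarith) (by linarith)
  refine (Nat.ceil_lt_add_one (mul_nonneg hc hM0)).le.trans ?_
  have h4 := mul_le_mul_of_nonneg_left hM hc
  have e : 4 * (1 + η * L) / (1 - η * L) = 4 * ((1 + η * L) / (1 - η * L)) := by ring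
  rw [e] at h4 ⊢
  linarith

theorem halpern_oracleCalls_le {F : E d → E d} {G : SetOp d} {η L ρ : ℝ} {x₀ : E d}
    (h0 : 0 ≤ η * L) (h1 : η * L < 1) {X : ℝ} (hX : 0 ≤ X) :
    ((halpern F G η L ρ x₀ ⌈4 * X⌉₊).oracleCalls : ℝ) ≤
      540 * ((1 + η * L) / (1 - η * L)) * max 1 X * Real.log (2 + X) := by
  set K := ⌈4 * X⌉₊
  set κ := (1 + η * L) / (1 - η * L)
  have hκ : 0 ≤ κ := div_nonneg (by linarith) (by linarith)
  have hK : (K : ℝ) ≤ 4 * X + 1 := (Nat.ceil_lt_add_one (by linarith)).le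
  have hlog2 : Real.log 2 ≤ Real.log (2 + X) := Real.log_le_log two_pos (by linarith)
  have hl2 := Real.log_two_gt_d9
  have h98 : Real.log 98 ≤ 7 * Real.log 2 := by
    rw [show (7 : ℝ) * Real.log 2 = ((7 : ℕ) : ℝ) * Real.log 2 by norm_num, ← Real.log_pow]
    exact Real.log_le_log (by norm_num) (by norm_num)
  have hterm : ∀ j ∈ Finset.range K,
      ((2 * innerIterations η L j : ℕ) : ℝ) ≤ 108 * (κ * Real.log (2 + X)) := by
    intro j hj
    have hjK : (j : ℝ) + 1 ≤ K := by exact_mod_cast Finset.mem_range.1 hj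
    have h2 : Real.log ((j : ℝ) + 2) ≤ 3 * Real.log (2 + X) := by
      calc Real.log ((j : ℝ) + 2) ≤ Real.log (2 ^ 2 * (2 + X)) :=
            Real.log_le_log (by positivity) (by linarith)
        _ = 2 * Real.log 2 + Real.log (2 + X) := by
            rw [Real.log_mul (by norm_num) (by linarith), Real.log_pow]; norm_num
        _ ≤ _ := by linarith
    -- `54 = 28 + 24 + 2`; two evaluations of `F` per inner step and `K ≤ 5 max 1 X` then give
    -- `540`.
    have h3 : 4 * Real.log 98 + 8 * Real.log ((j : ℝ) + 2) + 1 ≤ 54 * Real.log (2 + X) := by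
      linarith
    have h4 := (innerIterations_le h0 h1 j).trans (mul_le_mul_of_nonneg_left h3 hκ)
    push_cast
    linarith
  rw [halpern_oracleCalls, Nat.cast_sum]
  refine (Finset.sum_le_card_nsmul _ _ _ hterm).trans ?_
  rw [Finset.card_range, nsmul_eq_mul]
  have hK5 : (K : ℝ) ≤ 5 * max 1 X := by linarith [le_max_left 1 X, le_max_right 1 X]
  have hpos : 0 ≤ 108 * (κ * Real.log (2 + X)) :=
    mul_nonneg (by norm_num) (mul_nonneg hκ (by linarith))
  have := mul_le_mul_of_nonneg_right hK5 hpos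
  linarith

end InexactHalpern

/-- The soft-O bound is stated with an absolute constant `C` and an absolute exponent `p` of the
logarithm, chosen before the problem and all its parameters. -/
theorem corollary1 :
    ∃ (C : ℝ) (p : ℕ), 0 < C ∧
      ∀ (d : ℕ) (F : E d → E d) (G : SetOp d) (L : ℝ≥0) (ρ η : ℝ),
        LipschitzWith L F →
        IsMaximallyMonotone G →
        0 < ρ →
        IsMaximallyCohypomonotone ρ (addOp F G) →
        ρ < η →
        η * L < 1 →
        ∀ (x₀ xstar : E d), 0 ∈ addOp F G xstar →
        ∀ ε : ℝ, 0 < ε →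
        ∀ K : ℕ, K = ⌈4 * ‖x₀ - xstar‖ / ((η - ρ) * ε)⌉₊ →
          (∃ y : E d,
            setResolvent (smulOp η (addOp F G)) (halpern F G η L ρ x₀ K).val = {y} ∧
            η⁻¹ * ‖(halpern F G η L ρ x₀ K).val - y‖ ≤ ε) ∧
          ((halpern F G η L ρ x₀ K).oracleCalls : ℝ) ≤
            C * ((1 + η * L) / (1 - η * L)) * max 1 (‖x₀ - xstar‖ / (ε * (η - ρ))) *
              Real.log (2 + ‖x₀ - xstar‖ / (ε * (η - ρ))) ^ p := by
  refine ⟨540, 1, by norm_num, ?_⟩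
  intro d F G L ρ η hF hG hρ hA hρη hηL x₀ xstar hs ε hε K hK
  have hη : 0 < η := hρ.trans hρη
  have hηρ : 0 < η - ρ := sub_pos.2 hρη
  refine ⟨?_, ?_⟩
  · obtain ⟨y, hy, hle⟩ := halpern_residual_le hF hG hA.1 hη hρη hηL (x₀ := x₀) hs K
    refine ⟨y, hy, ?_⟩
    have hK' : 4 * ‖x₀ - xstar‖ / ((η - ρ) * ε) ≤ K := by rw [hK]; exact Nat.le_ceil _
    rw [div_le_iff₀ (by positivity)] at hK'
    rw [le_div_iff₀ (by positivity)] at hle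
    set a := ‖(halpern F G η L ρ x₀ K).val - y‖
    have e : (1 - ρ / η) * a = (η - ρ) * (η⁻¹ * a) := by field_simp
    rw [e] at hle
    have hpos : (0 : ℝ) < ((K : ℝ) + 2) * (η - ρ) := by positivity
    refine le_of_mul_le_mul_left ?_ hpos
    have : 0 ≤ (η - ρ) * ε := by positivity
    nlinarith
  · have hX : 4 * ‖x₀ - xstar‖ / ((η - ρ) * ε) = 4 * (‖x₀ - xstar‖ / (ε * (η - ρ))) := by
      rw [mul_comm ε, mul_div_assoc]
    rw [hK, hX, pow_one]
    exact halpern_oracleCalls_le (mul_nonneg hη.le L.2) hηL (by positivity)
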